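/- Let $V$ be a finite-dimensional real vector space. An algebraic curvature tensor on $V$ is an $A\in\otimes^4V^*$ such that, for all $v_i\in V$, $$A(v_1,v_2,v_3,v_4)=-A(v_2,v_1,v_3,v_4)=A(v_3,v_4,v_1,v_2),$$ $$A(v_1,v_2,v_3,v_4)+A(v_2,v_3,v_1,v_4)+A(v_3,v_1,v_2,v_4)=0.$$ A $0$-model $\mathfrak M=(V,\langle\cdot,\cdot\rangle,A)$ consists of a non-degenerate symmetric bilinear form $\langle\cdot,\cdot\rangle$ of signature $(p,q)$ on $V$ ($p$ negative and $q$ positive directions) and an algebraic curvature tensor $A$ on $V$. Let $\mathcal A(x,y)$ be the operator with $\langle\mathcal A(x,y)z,w\rangle=A(x,y,z,w)$, and let $\mathcal J(x)y:=\mathcal A(y,x)x$. The model $\mathfrak M$ is called - Jacobi–Tsankov if $\mathcal J(x)\mathcal J(y)=\mathcal J(y)\mathcal J(x)$ for all $x,y\in V$; - mixed-Tsankov if $\mathcal A(x_1,x_2)\mathcal J(x_3)=\mathcal J(x_3)\mathcal A(x_1,x_2)$ for all $x_i\in V$; - $2$-step Jacobi nilpotent if $\mathcal J(x)\mathcal J(y)=0$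 for all $x,y\in V$; - $2$-step skew-curvature nilpotent if $\mathcal A(x_1,x_2)\mathcal A(x_3,x_4)=0$ for all $x_i\in V$. If $V=V_1\oplus V_2$ and $A_i$ is an algebraic curvature tensor on $V_i$, then $A_1\oplus A_2$ denotes the tensor on $V$ given by $(A_1\oplus A_2)(x,y,z,w)=A_1(x_1,y_1,z_1,w_1)+A_2(x_2,y_2,z_2,w_2)$, where $x=x_1+x_2$, etc. with $x_i\in V_i$. An algebraic curvature tensor $A$ on $V$ is indecomposable if there is no decomposition $V=V_1\oplus V_2$ into two non-zero subspaces with $A=A_1\oplus A_2$ for algebraic curvature tensors $A_i$ on $V_i$. The model $\mathfrak M$ is indecomposable if there is no such decomposition with $V_1\perp V_2$. **Theorem 1.2.** Let $\mathfrak M=(V,\langle\cdot,\cdot\rangle,A)$ be a $0$-model. 1. If $\mathfrak M$ is Jacobi–Tsankov or mixed-Tsankov, then $\mathcal J(x)^2=0$ for all $x\in V$. If furthermore $p=0$ or $p=1$, then $A=0$. 2. If $\mathfrak M$ is Jacobi–Tsankov and $\dim V<14$, then $\mathfrak M$ is $2$-step Jacobi nilpotent. 3. If $\mathfrak M$ is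 indecomposable and $\dim V\neq 1$, then the following conditions are equivalent: - (a) $\mathfrak M$ is $2$-step Jacobi nilpotent; - (b) $\mathfrak M$ is $2$-step skew-curvature nilpotent; - (c) $V=W\oplus\bar W$ for subspaces $W,\bar W$ that are totally isotropic for $\langle\cdot,\cdot\rangle$, and $A=A_W\oplus 0$ for an indecomposable algebraic curvature tensor $A_W$ on $W$. -/

import Mathlib

open LinearMap (BilinForm)

noncomputable section

/-- Elements of `⊗⁴ V*`: quadrilinear forms on a real vector space `V`, in curried form. -/
abbrev Tensor4 (V : Type*) [AddCommGroup V] [Module ℝ V] : Type _ :=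
  V →ₗ[ℝ] V →ₗ[ℝ] V →ₗ[ℝ] V →ₗ[ℝ] ℝ

/-- `A` is an algebraic curvature tensor: it has the symmetries of the Riemann curvature tensor. -/
structure IsAlgCurvatureTensor {V : Type*} [AddCommGroup V] [Module ℝ V]
    (A : Tensor4 V) : Prop where
  antisymm : ∀ v₁ v₂ v₃ v₄ : V, A v₁ v₂ v₃ v₄ = -A v₂ v₁ v₃ v₄
  pair_symm : ∀ v₁ v₂ v₃ v₄ : V, A v₁ v₂ v₃ v₄ = A v₃ v₄ v₁ v₂
  bianchi : ∀ v₁ v₂ v₃ v₄ : V, A v₁ v₂ v₃ v₄ + A v₂ v₃ v₁ v₄ + A v₃ v₁ v₂ v₄ = 0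

namespace Tensor4

/-- The pullback `f^* A`, that is `(f^* A)(x, y, z, w) = A (f x, f y, f z, f w)`. -/
def pullback {V W : Type*} [AddCommGroup V] [Module ℝ V] [AddCommGroup W] [Module ℝ W]
    (A : Tensor4 W) (f : V →ₗ[ℝ] W) : Tensor4 V :=
  LinearMap.mk₂ ℝ (fun x y => (A (f x) (f y)).compl₁₂ f f)
    (fun _ _ _ => by ext; simp) (fun _ _ _ => by ext; simp)
    (fun _ _ _ => by ext; simp) (fun _ _ _ => by ext; simp)

theorem pullback_apply {V W : Type*} [AddCommGroup V] [Module ℝ V]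
    [AddCommGroup W] [Module ℝ W] (A : Tensor4 W) (f : V →ₗ[ℝ] W) (x y z w : V) :
    A.pullback f x y z w = A (f x) (f y) (f z) (f w) := rfl

/-- The direct sum `A₁ ⊕ A₂` on `V = V₁ ⊕ V₂` (internal direct sum) of tensors `A₁` on `V₁` and
`A₂` on `V₂`: with `x = x₁ + x₂` and so on, its value is
`A₁ (x₁, y₁, z₁, w₁) + A₂ (x₂, y₂, z₂, w₂)`. -/
def directSum {V : Type*} [AddCommGroup V] [Module ℝ V] {V₁ V₂ : Submodule ℝ V}
    (h : IsCompl V₁ V₂) (A₁ : Tensor4 V₁) (A₂ : Tensor4 V₂) : Tensor4 V :=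
  A₁.pullback (V₁.projectionOnto V₂ h) + A₂.pullback (V₂.projectionOnto V₁ h.symm)

/-- The tensor `A` on `V` is indecomposable: there is no decomposition `V = V₁ ⊕ V₂` into two
non-zero subspaces for which `A = A₁ ⊕ A₂` with algebraic curvature tensors `A₁`, `A₂`. -/
def Indecomposable {V : Type*} [AddCommGroup V] [Module ℝ V] (A : Tensor4 V) : Prop :=
  ¬ ∃ (V₁ V₂ : Submodule ℝ V) (h : IsCompl V₁ V₂) (A₁ : Tensor4 V₁) (A₂ : Tensor4 V₂),
      V₁ ≠ ⊥ ∧ V₂ ≠ ⊥ ∧ IsAlgCurvatureTensor A₁ ∧ IsAlgCurvatureTensor A₂ ∧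
        A = directSum h A₁ A₂

end Tensor4

/-- A `0`-model `(V, ⟨·,·⟩, A)`: a non-degenerate symmetric bilinear form (an inner product of
arbitrary signature) and an algebraic curvature tensor on `V`. -/
structure ZeroModel (V : Type*) [AddCommGroup V] [Module ℝ V] where
  /-- the inner product `⟨·,·⟩` -/
  form : BilinForm ℝ V
  form_symm : form.IsSymm
  form_nondegenerate : form.Nondegenerate
  /-- the curvature tensor -/
  A : Tensor4 V
  curvature : IsAlgCurvatureTensor A

namespace ZeroModel

variable {V : Type*} [AddCommGroup V] [Module ℝ V]

/-- The signature `(p, q)`: `p` is the maximal dimension of a negative definite subspace and `q`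
that of a positive definite one, so that Riemannian means `p = 0` and Lorentzian `p = 1`. -/
def signature (M : ZeroModel V) : ℕ × ℕ :=
  (sigNeg M.form.toQuadraticMap, sigPos M.form.toQuadraticMap)

/-- The skew-symmetric curvature operator `𝒜(x, y)`, characterized by
`⟨𝒜(x, y) z, w⟩ = A(x, y, z, w)`. -/
def curvOp [FiniteDimensional ℝ V] (M : ZeroModel V) (x y : V) : Module.End ℝ V :=
  (M.form.toDual M.form_nondegenerate).symm.toLinearMap ∘ₗ M.A x y

theorem form_curvOp [FiniteDimensional ℝ V] (M : ZeroModel V) (x y z w : V) :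
    M.form (M.curvOp x y z) w = M.A x y z w :=
  BilinForm.apply_toDual_symm_apply (hB := M.form_nondegenerate) (M.A x y z) w

/-- The Jacobi operator `𝒥(x) : y ↦ 𝒜(y, x) x`. -/
def jacobi [FiniteDimensional ℝ V] (M : ZeroModel V) (x : V) : Module.End ℝ V where
  toFun y := M.curvOp y x x
  map_add' _ _ := by simp [curvOp]
  map_smul' _ _ := by simp [curvOp]

/-- `𝒥(x) 𝒥(y) = 𝒥(y) 𝒥(x)` for all `x`, `y`. -/
def IsJacobiTsankov [FiniteDimensional ℝ V] (M : ZeroModel V) : Prop :=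
  ∀ x y : V, M.jacobi x * M.jacobi y = M.jacobi y * M.jacobi x

/-- `𝒜(x₁, x₂) 𝒥(x₃) = 𝒥(x₃) 𝒜(x₁, x₂)` for all `x₁`, `x₂`, `x₃`. -/
def IsMixedTsankov [FiniteDimensional ℝ V] (M : ZeroModel V) : Prop :=
  ∀ x₁ x₂ x₃ : V, M.curvOp x₁ x₂ * M.jacobi x₃ = M.jacobi x₃ * M.curvOp x₁ x₂

/-- `𝒥(x) 𝒥(y) = 0` for all `x`, `y`. -/
def IsTwoStepJacobiNilpotent [FiniteDimensional ℝ V] (M : ZeroModel V) : Prop :=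
  ∀ x y : V, M.jacobi x * M.jacobi y = 0

/-- `𝒜(x₁, x₂) 𝒜(x₃, x₄) = 0` for all `x₁`, `x₂`, `x₃`, `x₄`. -/
def IsTwoStepSkewCurvatureNilpotent [FiniteDimensional ℝ V] (M : ZeroModel V) : Prop :=
  ∀ x₁ x₂ x₃ x₄ : V, M.curvOp x₁ x₂ * M.curvOp x₃ x₄ = 0

/-- The model is indecomposable: there is no orthogonal decomposition `V = V₁ ⊕ V₂` into two
non-zero subspaces for which `A = A₁ ⊕ A₂` with algebraic curvature tensors `A₁`, `A₂`. -/
def Indecomposable (M : ZeroModel V) : Prop :=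
  ¬ ∃ (V₁ V₂ : Submodule ℝ V) (h : IsCompl V₁ V₂) (A₁ : Tensor4 V₁) (A₂ : Tensor4 V₂),
      V₁ ≠ ⊥ ∧ V₂ ≠ ⊥ ∧ (∀ v₁ ∈ V₁, ∀ v₂ ∈ V₂, M.form v₁ v₂ = 0) ∧
        IsAlgCurvatureTensor A₁ ∧ IsAlgCurvatureTensor A₂ ∧ M.A = Tensor4.directSum h A₁ A₂

/-- The subspace `W` is totally isotropic: `⟨v, w⟩ = 0` for all `v`, `w` in `W`. -/
def TotallyIsotropic (M : ZeroModel V) (W : Submodule ℝ V) : Prop :=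
  ∀ v ∈ W, ∀ w ∈ W, M.form v w = 0

/-- `V = W ⊕ W'` with totally isotropic subspaces `W` and `W'`, and `A = A_W ⊕ 0` for an
indecomposable algebraic curvature tensor `A_W` on `W`. -/
def SplitsIsotropically (M : ZeroModel V) : Prop :=
  ∃ (W W' : Submodule ℝ V) (h : IsCompl W W') (A_W : Tensor4 W),
    M.TotallyIsotropic W ∧ M.TotallyIsotropic W' ∧
      IsAlgCurvatureTensor A_W ∧ A_W.Indecomposable ∧ M.A = Tensor4.directSum h A_W 0

end ZeroModel

end

/-! ### Curvature and Jacobi operators, and their null images -/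

namespace ZeroModel

variable {V : Type*} [AddCommGroup V] [Module ℝ V]

/-! The main tool is the polarization `P(x, y)` = `polarJacobi x y` of the self-adjoint `𝒥`. It
satisfies `P(x, v) x = -𝒥(x) v`, and it recovers `𝒜` through the Bianchi identity
(`three_smul_curvOp`).

Squares: evaluating either commutation relation at `x` gives `𝒥(x)² = 0`, so every `𝒥(x) v` is a
null vector orthogonal to `x`. Such vectors vanish if `p = 0`, and for timelike `x` if `p = 1`.
Timelike vectors form an open set, so then `𝒥 = 0` everywhere.

Dimension 14: polarizing `𝒥(x)² = 0` shows that `φ = ⟨𝒥(x)𝒥(y)z, z⟩` is symmetric in `x, y, z`. If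
`φ ≠ 0`, there are 3 + 6 + 2 + 3 independent vectors: the arguments, their images under one Jacobi
operator, two values of `P`, and the images under two Jacobi operators
(`linearIndependent_of_form_ne_zero`).

Indecomposable models: either nilpotency puts the image of every `𝒜(x, y)` into `K = ker A`, which
forces `K^⊥ ≤ K`. Indecomposability makes `K` totally isotropic, hence `K = K^⊥`. A totally
isotropic complement `W` carries all of `A`, and `K` is dual to `W`, so a splitting of `A` on `W`
would split the model. -/

theorem _root_.IsAlgCurvatureTensor.antisymm_right {A : Tensor4 V} (hA : IsAlgCurvatureTensor A)
    (x y z w : V) :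
    A x y z w = -A x y w z := by
  rw [hA.pair_symm, hA.antisymm, hA.pair_symm w z]

theorem form_comm (M : ZeroModel V) (x y : V) : M.form x y = M.form y x :=
  M.form_symm.eq x y

theorem eq_zero_of_form_eq_zero (M : ZeroModel V) {v : V} (h : ∀ w, M.form v w = 0) : v = 0 :=
  M.form_nondegenerate.1 v h

theorem ext_form (M : ZeroModel V) {u v : V} (h : ∀ w, M.form u w = M.form v w) : u = v :=
  sub_eq_zero.1 <| M.eq_zero_of_form_eq_zero fun w => by
    rw [map_sub, LinearMap.sub_apply, h w, sub_self]

theorem form_eq_zero_of_null {M : ZeroModel V} {y z : V} (hy : M.form y y = 0)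
    (h : ∀ t : ℝ, 0 ≤ M.form (t • y + z) (t • y + z)) : M.form y z = 0 := by
  by_contra hz
  -- As `y` is null, the form at `t • y + z` is affine in `t`. This `t` gives it the value `-⟨z, z⟩
  -- - 2`, negative because `t = 0` yields `⟨z, z⟩ ≥ 0`.
  obtain ⟨t, ht⟩ : ∃ t : ℝ, t * M.form y z = -(M.form z z + 1) :=
    ⟨-(M.form z z + 1) / M.form y z, div_mul_cancel₀ _ hz⟩
  have h1 := h t
  have h2 := h 0
  simp only [map_add, map_smul, LinearMap.add_apply, LinearMap.smul_apply, smul_eq_mul, hy,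
    M.form_comm z y] at h1 h2
  linarith

theorem eq_zero_of_null_of_nonneg {M : ZeroModel V} {y : V} (hy : M.form y y = 0)
    (h : ∀ z, 0 ≤ M.form z z) : y = 0 :=
  M.eq_zero_of_form_eq_zero fun _ => form_eq_zero_of_null hy fun _ => h _

theorem eq_zero_of_null_of_orthogonal_nonneg {M : ZeroModel V} {x y : V} (hx : M.form x x ≠ 0)
    (h : ∀ z, M.form x z = 0 → 0 ≤ M.form z z) (hxy : M.form x y = 0) (hy : M.form y y = 0) :
    y = 0 := by
  have hyx : M.form y x = 0 := by rw [form_comm, hxy]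
  have key : ∀ z, M.form x z = 0 → M.form y z = 0 := fun z hxz =>
    form_eq_zero_of_null hy fun t => h _ (by simp [hxy, hxz])
  refine M.eq_zero_of_form_eq_zero fun z => ?_
  have h1 := key (z - (M.form x z / M.form x x) • x) (by simp [hx])
  simpa [hyx] using h1

variable [FiniteDimensional ℝ V] (M : ZeroModel V)

theorem jacobi_apply (x y : V) : M.jacobi x y = M.curvOp y x x := rfl

theorem form_jacobi (x y z : V) : M.form (M.jacobi x y) z = M.A y x x z :=
  M.form_curvOp y x x z

theorem curvOp_add_right (x y y' z : V) :
    M.curvOp x (y + y') z = M.curvOp x y z + M.curvOp x y' z := by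
  simp [curvOp]

theorem curvOp_swap (x y z : V) : M.curvOp x y z = -M.curvOp y x z :=
  M.ext_form fun w => by
    simp only [map_neg, LinearMap.neg_apply, form_curvOp]
    exact M.curvature.antisymm x y z w

theorem curvOp_self (x z : V) : M.curvOp x x z = 0 :=
  M.ext_form fun w => by
    rw [form_curvOp, map_zero, LinearMap.zero_apply]
    exact self_eq_neg.1 (M.curvature.antisymm x x z w)

theorem curvOp_bianchi (x y z : V) :
    M.curvOp x y z + M.curvOp y z x + M.curvOp z x y = 0 :=
  M.ext_form fun w => by
    simp only [map_add, LinearMap.add_apply, form_curvOp, map_zero, LinearMap.zero_apply]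
    exact M.curvature.bianchi x y z w

theorem jacobi_self (x : V) : M.jacobi x x = 0 := M.curvOp_self x x

theorem jacobi_smul (t : ℝ) (x : V) : M.jacobi (t • x) = t ^ 2 • M.jacobi x := by
  ext y
  simp [jacobi, curvOp, smul_smul, pow_two]

/-- The Jacobi operator is self-adjoint. -/
theorem form_jacobi_left (x y z : V) : M.form (M.jacobi x y) z = M.form y (M.jacobi x z) := by
  rw [M.form_comm y, form_jacobi, form_jacobi, M.curvature.pair_symm,
    M.curvature.antisymm, M.curvature.antisymm_right, neg_neg]

/-- The polarization `𝒥(x + y) - 𝒥(x) - 𝒥(y)` of the Jacobi operator. -/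
noncomputable def polarJacobi (x y : V) : Module.End ℝ V :=
  M.jacobi (x + y) - M.jacobi x - M.jacobi y

theorem polarJacobi_apply (x y z : V) :
    M.polarJacobi x y z = M.curvOp z x y + M.curvOp z y x := by
  simp only [polarJacobi, LinearMap.sub_apply, jacobi_apply, curvOp_add_right, map_add]
  abel

theorem jacobi_add (x y : V) : M.jacobi (x + y) = M.jacobi x + M.jacobi y + M.polarJacobi x y := by
  rw [polarJacobi]; abel

theorem polarJacobi_comm (x y : V) : M.polarJacobi x y = M.polarJacobi y x := by
  rw [polarJacobi, polarJacobi, add_comm x y]; abel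

theorem polarJacobi_add_right (x y z : V) :
    M.polarJacobi x (y + z) = M.polarJacobi x y + M.polarJacobi x z := by
  ext v
  simp only [LinearMap.add_apply, polarJacobi_apply, curvOp_add_right, map_add]
  abel

theorem polarJacobi_smul_right (t : ℝ) (x y : V) :
    M.polarJacobi x (t • y) = t • M.polarJacobi x y := by
  ext v
  simp [polarJacobi_apply, curvOp]

theorem polarJacobi_self_right (x y : V) : M.polarJacobi x y x = -M.jacobi x y := by
  rw [polarJacobi_apply, curvOp_self, zero_add, curvOp_swap, jacobi_apply]

theorem form_polarJacobi_left (x y z w : V) :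
    M.form (M.polarJacobi x y z) w = M.form z (M.polarJacobi x y w) := by
  simp only [polarJacobi, LinearMap.sub_apply, map_sub, form_jacobi_left]

theorem three_smul_curvOp (x y z : V) :
    (3 : ℝ) • M.curvOp x y z = M.polarJacobi y z x - M.polarJacobi x z y := by
  have h := M.curvOp_bianchi x y z
  rw [polarJacobi_apply, polarJacobi_apply, M.curvOp_swap y x z, M.curvOp_swap x z y]
  rw [add_assoc, add_eq_zero_iff_eq_neg] at h
  rw [h]
  module

theorem A_eq_zero_of_jacobi (h : ∀ x, M.jacobi x = 0) : M.A = 0 := by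
  ext x y z w
  have h3 := M.three_smul_curvOp x y z
  simp only [polarJacobi, h, sub_self, LinearMap.zero_apply] at h3
  have h0 : M.curvOp x y z = 0 := by simpa using h3
  rw [← form_curvOp, h0]
  simp

/-! ### Vanishing squares, and signature `p ≤ 1` -/

variable {M}

theorem IsJacobiTsankov.jacobi_jacobi (h : M.IsJacobiTsankov) (x y z : V) :
    M.jacobi x (M.jacobi y z) = M.jacobi y (M.jacobi x z) :=
  LinearMap.congr_fun (h x y) z

theorem IsJacobiTsankov.jacobi_polarJacobi (h : M.IsJacobiTsankov) (x y z v : V) :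
    M.jacobi x (M.polarJacobi y z v) = M.polarJacobi y z (M.jacobi x v) := by
  simp only [polarJacobi, LinearMap.sub_apply, map_sub, h.jacobi_jacobi x]

/-- `𝒥(x)` commutes with `P(x, v)`; at `x` one side vanishes and the other is `-𝒥(x)² v`. -/
theorem IsJacobiTsankov.jacobi_jacobi_self (h : M.IsJacobiTsankov) (x v : V) :
    M.jacobi x (M.jacobi x v) = 0 := by
  have h1 := h.jacobi_polarJacobi x x v x
  rwa [polarJacobi_self_right, jacobi_self, map_zero, map_neg, neg_eq_zero] at h1

theorem IsMixedTsankov.jacobi_jacobi_self (h : M.IsMixedTsankov) (x v : V) :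
    M.jacobi x (M.jacobi x v) = 0 := by
  have h1 := LinearMap.congr_fun (h v x x) x
  rw [Module.End.mul_apply, Module.End.mul_apply, jacobi_self, map_zero] at h1
  exact h1.symm

theorem form_self_nonneg_of_signature_fst_eq_zero (h : M.signature.1 = 0) (x : V) :
    0 ≤ M.form x x := by
  by_contra! hx
  have hx0 : x ≠ 0 := by rintro rfl; simp at hx
  have hle : Module.finrank ℝ (ℝ ∙ x) ≤ M.signature.1 := by
    apply le_sigNeg_of_negDef
    rintro ⟨v, hv⟩ hv0
    obtain ⟨a, rfl⟩ := Submodule.mem_span_singleton.1 hv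
    have ha : a ≠ 0 := by rintro rfl; simp at hv0
    simp only [QuadraticMap.restrict_apply, neg_apply,
      LinearMap.BilinMap.toQuadraticMap_apply, map_smul, LinearMap.smul_apply, smul_eq_mul]
    nlinarith [mul_pos (sq_pos_of_ne_zero ha) (neg_pos.2 hx)]
  rw [finrank_span_singleton hx0, h] at hle
  omega

theorem form_self_nonneg_of_signature_fst_eq_one (h : M.signature.1 = 1) {x y : V}
    (hx : M.form x x < 0) (hxy : M.form x y = 0) : 0 ≤ M.form y y := by
  by_contra! hy
  have key : ∀ a b : ℝ, M.form (a • x + b • y) (a • x + b • y) =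
      a ^ 2 * M.form x x + b ^ 2 * M.form y y := by
    intro a b
    have hyx : M.form y x = 0 := by rw [form_comm, hxy]
    simp only [map_add, map_smul, LinearMap.add_apply, LinearMap.smul_apply, smul_eq_mul, hxy, hyx]
    ring
  have hneg : ∀ a b : ℝ, (a ≠ 0 ∨ b ≠ 0) →
      M.form (a • x + b • y) (a • x + b • y) < 0 := by
    intro a b hab
    rw [key]
    rcases hab with h | h
    · nlinarith [mul_pos (sq_pos_of_ne_zero h) (neg_pos.2 hx),
        mul_nonneg (sq_nonneg b) (neg_pos.2 hy).le]
    · nlinarith [mul_pos (sq_pos_of_ne_zero h) (neg_pos.2 hy),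
        mul_nonneg (sq_nonneg a) (neg_pos.2 hx).le]
  have hli : LinearIndependent ℝ ![x, y] := by
    rw [LinearIndependent.pair_iff]
    intro a b hab
    by_contra hne
    have := hneg a b (by tauto)
    simp [hab] at this
  have hle : Module.finrank ℝ (Submodule.span ℝ (Set.range ![x, y])) ≤ M.signature.1 := by
    apply le_sigNeg_of_negDef
    rintro ⟨v, hv⟩ hv0
    have hv' := hv
    rw [Matrix.range_cons, Matrix.range_cons, Matrix.range_empty, Set.union_empty,
      Set.singleton_union, Submodule.mem_span_pair] at hv'
    obtain ⟨a, b, rfl⟩ := hv'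
    have hab : a ≠ 0 ∨ b ≠ 0 := by
      by_contra! hab
      simp [hab.1, hab.2] at hv0
    have := hneg a b hab
    simp only [QuadraticMap.restrict_apply, neg_apply,
      LinearMap.BilinMap.toQuadraticMap_apply]
    linarith
  rw [finrank_span_eq_card hli, h] at hle
  simp at hle

theorem A_eq_zero_of_signature (hJ : ∀ x v, M.jacobi x (M.jacobi x v) = 0)
    (hp : M.signature.1 = 0 ∨ M.signature.1 = 1) : M.A = 0 := by
  have hnull : ∀ x v, M.form (M.jacobi x v) (M.jacobi x v) = 0 := fun x v => by
    rw [form_jacobi_left, hJ, map_zero]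
  rcases hp with hp | hp
  · exact M.A_eq_zero_of_jacobi fun x => LinearMap.ext fun v =>
      eq_zero_of_null_of_nonneg (hnull x v) (form_self_nonneg_of_signature_fst_eq_zero hp)
  · have htime : ∀ x, M.form x x < 0 → M.jacobi x = 0 := fun x hx => LinearMap.ext fun v =>
      eq_zero_of_null_of_orthogonal_nonneg hx.ne
        (fun z hz => form_self_nonneg_of_signature_fst_eq_one hp hx hz)
        (by rw [← form_jacobi_left, jacobi_self, map_zero, LinearMap.zero_apply]) (hnull x v)
    obtain ⟨x, hx⟩ : ∃ x, M.form x x < 0 := by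
      by_contra! hn
      obtain ⟨W, hW, hpos⟩ := exists_finrank_eq_sigNeg_and_negDef M.form.toQuadraticMap
      have hW1 : Module.finrank ℝ W = 1 := hW.trans hp
      have : Nontrivial W := Module.nontrivial_of_finrank_pos (R := ℝ) (by omega)
      obtain ⟨w, hw⟩ := exists_ne (0 : W)
      have := hpos w hw
      simp only [QuadraticMap.restrict_apply, neg_apply,
        LinearMap.BilinMap.toQuadraticMap_apply] at this
      linarith [hn w]
    -- For small `t > 0` both `x + t • z` and `x - t • z` are timelike. The sum of their Jacobi
    -- operators is `2 𝒥(x) + 2t² 𝒥(z)`, since the terms in `P(x, z)` cancel.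
    refine M.A_eq_zero_of_jacobi fun z => ?_
    have hcont : ∀ s : ℝ, Continuous fun t : ℝ => M.form (x + (s * t) • z) (x + (s * t) • z) := by
      intro s
      simp only [map_add, map_smul, LinearMap.add_apply, LinearMap.smul_apply, smul_eq_mul]
      fun_prop
    have hev : ∀ s : ℝ, ∀ᶠ t in nhds (0 : ℝ), M.form (x + (s * t) • z) (x + (s * t) • z) < 0 :=
      fun s => (hcont s).continuousAt.eventually_lt continuousAt_const (by simpa using hx)
    obtain ⟨t, ⟨h1, h2⟩, ht⟩ := (((hev 1).and (hev (-1))).filter_mono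
      (nhdsWithin_le_nhds (s := Set.Ioi 0))).and self_mem_nhdsWithin |>.exists
    have e1 := htime _ h1
    have e2 := htime _ h2
    rw [jacobi_add, htime x hx, jacobi_smul, polarJacobi_smul_right] at e1 e2
    have e3 : (2 * t ^ 2) • M.jacobi z = 0 := by
      have := congrArg₂ (· + ·) e1 e2
      simp only [add_zero] at this
      rw [← this]
      module
    have ht' : 2 * t ^ 2 ≠ 0 := by have : (0 : ℝ) < t := ht; positivity
    exact (smul_eq_zero.1 e3).resolve_left ht'

end ZeroModel

/-! ### Jacobi–Tsankov models in dimension below 14 -/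

namespace ZeroModel

variable {V : Type*} [AddCommGroup V] [Module ℝ V] [FiniteDimensional ℝ V] {M : ZeroModel V}

namespace IsJacobiTsankov

theorem jacobi_jacobi_apply_left (h : M.IsJacobiTsankov) (x y : V) :
    M.jacobi x (M.jacobi y x) = 0 := by
  rw [h.jacobi_jacobi, jacobi_self, map_zero]

theorem jacobi_polarJacobi_apply_left (h : M.IsJacobiTsankov) (x y z : V) :
    M.jacobi x (M.polarJacobi y z x) = 0 := by
  rw [h.jacobi_polarJacobi, jacobi_self, map_zero]

theorem polarJacobi_polarJacobi (h : M.IsJacobiTsankov) (x y z w v : V) :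
    M.polarJacobi x y (M.polarJacobi z w v) = M.polarJacobi z w (M.polarJacobi x y v) := by
  rw [polarJacobi.eq_1 M x y]
  simp only [LinearMap.sub_apply, map_sub, h.jacobi_polarJacobi]

theorem polarization_jacobi_jacobi_self (h : M.IsJacobiTsankov) (x y v : V) (t : ℝ) :
    (2 * t ^ 2) • M.jacobi x (M.jacobi y v) + (2 * t) • M.jacobi x (M.polarJacobi x y v) +
      (2 * t ^ 3) • M.jacobi y (M.polarJacobi x y v) +
      t ^ 2 • M.polarJacobi x y (M.polarJacobi x y v) = 0 := by
  have h1 := h.jacobi_jacobi_self (x + t • y) v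
  simp only [jacobi_add, jacobi_smul, polarJacobi_smul_right, LinearMap.add_apply,
    LinearMap.smul_apply, map_add, map_smul, h.jacobi_jacobi_self,
    ← h.jacobi_polarJacobi, h.jacobi_jacobi y x] at h1
  rw [← h1]
  module

theorem jacobi_polarJacobi_self (h : M.IsJacobiTsankov) (x y v : V) :
    M.jacobi x (M.polarJacobi x y v) = 0 := by
  have h1 := h.polarization_jacobi_jacobi_self x y v 1
  have h2 := h.polarization_jacobi_jacobi_self x y v (-1)
  have h3 := h.polarization_jacobi_jacobi_self x y v 2
  -- These weights cancel the `t²` and `t³` coefficients and halve the linear one.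
  linear_combination (norm := module) (1 / 2 : ℝ) • h1 - (1 / 6 : ℝ) • h2 - (1 / 12 : ℝ) • h3

theorem jacobi_polarJacobi_self' (h : M.IsJacobiTsankov) (x y v : V) :
    M.jacobi x (M.polarJacobi y x v) = 0 := by
  rw [polarJacobi_comm, h.jacobi_polarJacobi_self]

theorem polarJacobi_polarJacobi_self (h : M.IsJacobiTsankov) (x y v : V) :
    M.polarJacobi x y (M.polarJacobi x y v) = -(2 : ℝ) • M.jacobi x (M.jacobi y v) := by
  have h1 := h.polarization_jacobi_jacobi_self x y v 1
  have h2 := h.jacobi_polarJacobi_self x y v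
  have h3 := h.jacobi_polarJacobi_self' y x v
  simp only [h2, h3, smul_zero, add_zero] at h1
  linear_combination (norm := module) h1

theorem polarJacobi_polarJacobi_left (h : M.IsJacobiTsankov) (x y z v : V) :
    M.polarJacobi x y (M.polarJacobi x z v) = -M.jacobi x (M.polarJacobi y z v) := by
  have h1 := h.polarJacobi_polarJacobi_self x (y + z) v
  simp only [polarJacobi_add_right, jacobi_add, LinearMap.add_apply, map_add,
    h.polarJacobi_polarJacobi_self, h.polarJacobi_polarJacobi x z x y] at h1
  have h2 : (2 : ℝ) • M.polarJacobi x y (M.polarJacobi x z v) =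
      (2 : ℝ) • -M.jacobi x (M.polarJacobi y z v) := by
    linear_combination (norm := module) h1
  exact smul_right_injective V (two_ne_zero (α := ℝ)) h2

theorem form_polarJacobi_polarJacobi (h : M.IsJacobiTsankov) (x y z : V) :
    M.form (M.polarJacobi y z x) (M.polarJacobi x z y) =
      M.form (M.jacobi x (M.jacobi z y)) y := by
  rw [← form_polarJacobi_left, M.polarJacobi_comm x z, M.polarJacobi_comm y z,
    h.polarJacobi_polarJacobi_left, polarJacobi_self_right, map_neg, map_neg,
    map_neg, LinearMap.neg_apply, LinearMap.neg_apply, neg_neg,     h.jacobi_jacobi]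

/-- Both sides equal `⟨P(y, z) x, P(x, z) y⟩`, which is symmetric under exchange of `x` and `y`. -/
theorem form_jacobi_jacobi_rotate (h : M.IsJacobiTsankov) (x y z : V) :
    M.form (M.jacobi x (M.jacobi z y)) y = M.form (M.jacobi y (M.jacobi z x)) x := by
  rw [← h.form_polarJacobi_polarJacobi, ← h.form_polarJacobi_polarJacobi, form_comm]

theorem form_polarJacobi_self (h : M.IsJacobiTsankov) (x y z : V) :
    M.form (M.polarJacobi y z x) (M.polarJacobi y z x) =
      -2 * M.form (M.jacobi y (M.jacobi z x)) x := by
  rw [← form_polarJacobi_left, h.polarJacobi_polarJacobi_self, map_smul, LinearMap.smul_apply,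
    smul_eq_mul]

/-- Vectors on which a Jacobi–Tsankov model fails to be `2`-step Jacobi nilpotent generate, under
the Jacobi operators, `14` linearly independent vectors. -/
theorem linearIndependent_of_form_ne_zero (h : M.IsJacobiTsankov) {x y z : V}
    (hφ : M.form (M.jacobi x (M.jacobi y z)) z ≠ 0) :
    LinearIndependent ℝ ![x, y, z, M.jacobi x y, M.jacobi x z, M.jacobi y x, M.jacobi y z,
      M.jacobi z x, M.jacobi z y, M.polarJacobi y z x, M.polarJacobi x z y,
      M.jacobi x (M.jacobi y z), M.jacobi x (M.jacobi z y), M.jacobi y (M.jacobi z x)] := by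
  obtain ⟨φ, hφx, hφy, hφz, hφ0⟩ : ∃ φ : ℝ, M.form (M.jacobi y (M.jacobi z x)) x = φ ∧
      M.form (M.jacobi x (M.jacobi z y)) y = φ ∧ M.form (M.jacobi x (M.jacobi y z)) z = φ ∧
      φ ≠ 0 := by
    refine ⟨_, ?_, ?_, rfl, hφ⟩
    · rw [h.form_jacobi_jacobi_rotate x z y, h.jacobi_jacobi]
    · rw [h.jacobi_jacobi x y, h.form_jacobi_jacobi_rotate y z x, h.jacobi_jacobi]
  rw [Fintype.linearIndependent_iff]
  intro g hg
  simp only [Fin.sum_univ_succ, Fin.sum_univ_zero] at hg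
  simp at hg
  have hyx := h.jacobi_jacobi y x
  have hzx := h.jacobi_jacobi z x
  have hzy := h.jacobi_jacobi z y
  have hk : ∀ a b u, M.form (M.jacobi a (M.jacobi b u)) b = 0 := fun a b u => by
    rw [h.jacobi_jacobi, form_jacobi_left, jacobi_self, map_zero]
  have hk' : ∀ a b u, M.form (M.jacobi a (M.jacobi b u)) a = 0 := fun a b u => by
    rw [form_jacobi_left, jacobi_self, map_zero]
  have h3 : ∀ a b c, M.jacobi a (M.jacobi b (M.jacobi c a)) = 0 := fun a b c => by
    rw [h.jacobi_jacobi, h.jacobi_jacobi_apply_left, map_zero]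
  -- Pairing these three vectors with `z`, `y`, `x` gives `φ` times the identity matrix.
  have hw : ∀ a b c : ℝ, a • M.jacobi x (M.jacobi y z) + (b • M.jacobi x (M.jacobi z y) +
      c • M.jacobi y (M.jacobi z x)) = 0 → a = 0 ∧ b = 0 ∧ c = 0 := by
    intro a b c habc
    have ex := congrArg (fun u => M.form u x) habc
    have ey := congrArg (fun u => M.form u y) habc
    have ez := congrArg (fun u => M.form u z) habc
    simp only [map_add, map_smul, map_zero, LinearMap.add_apply, LinearMap.smul_apply,
      smul_eq_mul, LinearMap.zero_apply, hk, hk', hφx, hφy, hφz, mul_zero, add_zero, zero_add,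
      mul_eq_zero, hφ0, or_false] at ex ey ez
    exact ⟨ez, ey, ex⟩
  have hwx : M.jacobi y (M.jacobi z x) ≠ 0 := fun h0 => hφ0 (by simp [← hφx, h0])
  -- `𝒥(y)𝒥(z)` kills all of the 14 vectors except `x`; the analogous products isolate `y` and `z`.
  have hg0 : g 0 = 0 := by
    have h0 := congrArg (fun u => M.jacobi y (M.jacobi z u)) hg
    simp only [map_add, map_smul, map_zero, hyx, hzx, hzy, jacobi_self, h.jacobi_jacobi_self,
      h.jacobi_jacobi_apply_left, h.jacobi_polarJacobi_self',
      smul_zero, add_zero, zero_add] at h0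
    exact (smul_eq_zero.1 h0).resolve_right hwx
  have hwy : M.jacobi x (M.jacobi z y) ≠ 0 := fun h0 => hφ0 (by simp [← hφy, h0])
  have hg1 : g 1 = 0 := by
    have h0 := congrArg (fun u => M.jacobi x (M.jacobi z u)) hg
    simp only [map_add, map_smul, map_zero, hzx, hzy, jacobi_self, h.jacobi_jacobi_self,
      h.jacobi_jacobi_apply_left, h.jacobi_polarJacobi_self', h3,
      smul_zero, add_zero, zero_add] at h0
    exact (smul_eq_zero.1 h0).resolve_right hwy
  have hwz : M.jacobi x (M.jacobi y z) ≠ 0 := fun h0 => hφ0 (by simp [← hφz, h0])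
  have hg2 : g 2 = 0 := by
    have h0 := congrArg (fun u => M.jacobi x (M.jacobi y u)) hg
    simp only [map_add, map_smul, map_zero, hyx, jacobi_self, h.jacobi_jacobi_self,
      h.jacobi_jacobi_apply_left, h.jacobi_polarJacobi_self,
      h.jacobi_polarJacobi_apply_left, h3,
      smul_zero, add_zero, zero_add] at h0
    exact (smul_eq_zero.1 h0).resolve_right hwz
  simp only [hg0, hg1, hg2, zero_smul, zero_add] at hg
  -- Of the remaining vectors, `𝒥(x)` keeps only `𝒥(y) z` and `𝒥(z) y`, sending them to independent
  -- vectors; likewise for `𝒥(y)` and `𝒥(z)`.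
  have kx := congrArg (M.jacobi x) hg
  simp only [map_add, map_smul, map_zero, h.jacobi_jacobi_self,
    h.jacobi_jacobi_apply_left, h.jacobi_polarJacobi_self,
    h.jacobi_polarJacobi_apply_left, h3,
    smul_zero, add_zero, zero_add] at kx
  have ky := congrArg (M.jacobi y) hg
  simp only [map_add, map_smul, map_zero, hyx, jacobi_self, h.jacobi_jacobi_self,
    h.jacobi_jacobi_apply_left, h.jacobi_polarJacobi_self,
    h.jacobi_polarJacobi_apply_left,
    smul_zero, add_zero, zero_add] at ky
  have kz := congrArg (M.jacobi z) hg
  simp only [map_add, map_smul, map_zero, hzx, hzy, jacobi_self, h.jacobi_jacobi_self,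
    h.jacobi_polarJacobi_self',
    smul_zero, add_zero, zero_add] at kz
  obtain ⟨hg6, hg8, -⟩ := hw (g 6) (g 8) 0 (by rw [zero_smul, add_zero, kx])
  obtain ⟨hg4, -, hg7⟩ := hw (g 4) 0 (g 7) (by rw [zero_smul, zero_add, ky])
  obtain ⟨-, hg3, hg5⟩ := hw 0 (g 3) (g 5) (by rw [zero_smul, zero_add, kz])
  simp only [hg3, hg4, hg5, hg6, hg7, hg8, zero_smul, zero_add] at hg
  -- The two values of `P` have Gram matrix with diagonal `-2φ` and off-diagonal `φ`, of determinant
  -- `3φ²`, and are orthogonal to the last three vectors. The third value `P(x, y) z` is minus their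
  -- sum, so it is not listed.
  have e1 := congrArg (fun u => M.form u (M.polarJacobi y z x)) hg
  have e2 := congrArg (fun u => M.form u (M.polarJacobi x z y)) hg
  simp only [map_add, map_smul, map_zero, LinearMap.add_apply, LinearMap.smul_apply,
    smul_eq_mul, LinearMap.zero_apply] at e1 e2
  rw [h.form_polarJacobi_self, M.form_comm _ (M.polarJacobi y z x),
    h.form_polarJacobi_polarJacobi, hφx, hφy] at e1
  rw [h.form_polarJacobi_self, h.form_polarJacobi_polarJacobi, hφy] at e2
  simp only [form_jacobi_left, h.jacobi_polarJacobi_self, map_zero,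
    h.jacobi_polarJacobi_apply_left, mul_zero, add_zero] at e1 e2
  have hg9 : g 9 = 0 := by
    have : g 9 * φ = 0 := by linarith
    exact (mul_eq_zero.1 this).resolve_right hφ0
  have hg10 : g 10 = 0 := by
    have : g 10 * φ = 0 := by linarith
    exact (mul_eq_zero.1 this).resolve_right hφ0
  simp only [hg9, hg10, zero_smul, zero_add] at hg
  obtain ⟨hg11, hg12, hg13⟩ := hw _ _ _ hg
  intro i
  fin_cases i <;> assumption

theorem isTwoStepJacobiNilpotent (h : M.IsJacobiTsankov) (hdim : Module.finrank ℝ V < 14) :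
    M.IsTwoStepJacobiNilpotent := by
  have hdiag : ∀ x y z, M.form (M.jacobi x (M.jacobi y z)) z = 0 := by
    intro x y z
    by_contra hne
    have := (h.linearIndependent_of_form_ne_zero hne).fintype_card_le_finrank
    rw [Fintype.card_fin] at this
    omega
  intro x y
  ext z
  refine M.eq_zero_of_form_eq_zero fun w => ?_
  -- A product of commuting self-adjoint operators is self-adjoint, so its vanishing quadratic form
  -- determines it.
  have hsymm : M.form (M.jacobi x (M.jacobi y w)) z = M.form (M.jacobi x (M.jacobi y z)) w := by
    rw [form_jacobi_left, form_jacobi_left, h.jacobi_jacobi, form_comm]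
  have h1 := hdiag x y (z + w)
  simp only [map_add, LinearMap.add_apply, hdiag, hsymm] at h1
  rw [Module.End.mul_apply]
  linarith

end IsJacobiTsankov

end ZeroModel

/-! ### Direct sums of curvature tensors -/

namespace Tensor4

variable {V : Type*} [AddCommGroup V] [Module ℝ V]

theorem directSum_apply {V₁ V₂ : Submodule ℝ V} (h : IsCompl V₁ V₂) (A₁ : Tensor4 V₁)
    (A₂ : Tensor4 V₂) (x y z w : V) :
    directSum h A₁ A₂ x y z w =
      A₁ (V₁.projectionOnto V₂ h x) (V₁.projectionOnto V₂ h y)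
          (V₁.projectionOnto V₂ h z) (V₁.projectionOnto V₂ h w) +
        A₂ (V₂.projectionOnto V₁ h.symm x) (V₂.projectionOnto V₁ h.symm y)
          (V₂.projectionOnto V₁ h.symm z) (V₂.projectionOnto V₁ h.symm w) := rfl

theorem directSum_apply_mixed {V₁ V₂ : Submodule ℝ V} (h : IsCompl V₁ V₂) (A₁ : Tensor4 V₁)
    (A₂ : Tensor4 V₂) {x y : V} (hx : x ∈ V₁) (hy : y ∈ V₂) : directSum h A₁ A₂ x y = 0 := by
  ext z w
  rw [directSum_apply, (Submodule.projectionOnto_apply_eq_zero_iff h).2 hy,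
    (Submodule.projectionOnto_apply_eq_zero_iff h.symm).2 hx]
  simp

end Tensor4

namespace IsAlgCurvatureTensor

variable {V : Type*} [AddCommGroup V] [Module ℝ V] {A : Tensor4 V}

theorem pullback {W : Type*} [AddCommGroup W] [Module ℝ W] (hA : IsAlgCurvatureTensor A)
    (f : W →ₗ[ℝ] V) : IsAlgCurvatureTensor (A.pullback f) where
  antisymm _ _ _ _ := hA.antisymm _ _ _ _
  pair_symm _ _ _ _ := hA.pair_symm _ _ _ _
  bianchi _ _ _ _ := hA.bianchi _ _ _ _

/-- A curvature tensor whose mixed entries `A(x₁, y₂, ·, ·)` vanish is the direct sum of its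
restrictions. -/
theorem eq_directSum (hA : IsAlgCurvatureTensor A) {V₁ V₂ : Submodule ℝ V} (h : IsCompl V₁ V₂)
    (hmix : ∀ x ∈ V₁, ∀ y ∈ V₂, A x y = 0) :
    A = Tensor4.directSum h (A.pullback V₁.subtype) (A.pullback V₂.subtype) := by
  have m1 : ∀ (x : V₁) (y : V₂) z w, A x y z w = 0 := fun x y z w => by
    rw [hmix x x.2 y y.2]; rfl
  have m2 : ∀ (x : V₁) (y : V₂) z w, A y x z w = 0 := fun x y z w => by
    rw [hA.antisymm, m1, neg_zero]
  -- Entries with two arguments from each summand are not mixed in the first pair; Bianchi reduces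
  -- them to entries that are.
  have m3 : ∀ (x y : V₁) (z w : V₂), A x y z w = 0 := fun x y z w => by
    have := hA.bianchi x y z w
    rwa [m1, m2, add_zero, add_zero] at this
  have m4 : ∀ (x y : V₁) (z w : V₂), A z w x y = 0 := fun x y z w => by
    rw [hA.pair_symm, m3]
  have m5 : ∀ (x : V₁) (y : V₂) z w, A z w x y = 0 := fun x y z w => by
    rw [hA.pair_symm, m1]
  have m6 : ∀ (x : V₁) (y : V₂) z w, A z w y x = 0 := fun x y z w => by
    rw [hA.pair_symm, m2]
  have dec : ∀ x : V, (V₁.projectionOnto V₂ h x : V) + V₂.projectionOnto V₁ h.symm x = x :=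
    Submodule.projection_add_projection_eq_self h
  ext x y z w
  rw [Tensor4.directSum_apply, Tensor4.pullback_apply, Tensor4.pullback_apply]
  simp only [Submodule.subtype_apply]
  conv_lhs => rw [← dec x, ← dec y, ← dec z, ← dec w]
  simp only [map_add, LinearMap.add_apply, m1, m2, m3, m4, m5, m6]
  ring

end IsAlgCurvatureTensor

/-! ### Nilpotent indecomposable models and the kernel of `A` -/

namespace ZeroModel

variable {V : Type*} [AddCommGroup V] [Module ℝ V] {M : ZeroModel V}

theorem Indecomposable.eq_bot_or_eq_bot (hM : M.Indecomposable) {V₁ V₂ : Submodule ℝ V}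
    (h : IsCompl V₁ V₂) (horth : ∀ x ∈ V₁, ∀ y ∈ V₂, M.form x y = 0)
    (hmix : ∀ x ∈ V₁, ∀ y ∈ V₂, M.A x y = 0) : V₁ = ⊥ ∨ V₂ = ⊥ := by
  by_contra! hne
  exact hM ⟨V₁, V₂, h, _, _, hne.1, hne.2, horth, M.curvature.pullback _, M.curvature.pullback _,
    M.curvature.eq_directSum h hmix⟩

theorem A_apply_right_of_mem_ker {k : V} (hk : k ∈ LinearMap.ker M.A) (x : V) : M.A x k = 0 := by
  ext z w
  rw [M.curvature.antisymm, LinearMap.mem_ker.1 hk]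
  simp

theorem A_apply_third_of_mem_ker {k : V} (hk : k ∈ LinearMap.ker M.A) (x y : V) :
    M.A x y k = 0 := by
  ext w
  rw [M.curvature.pair_symm, LinearMap.mem_ker.1 hk]
  rfl

/-- In an indecomposable model of dimension other than `1`, the kernel of the curvature tensor is
totally isotropic. -/
theorem Indecomposable.totallyIsotropic_ker (hM : M.Indecomposable)
    (hdim : Module.finrank ℝ V ≠ 1) : M.TotallyIsotropic (LinearMap.ker M.A) := by
  have hself : ∀ v ∈ LinearMap.ker M.A, M.form v v = 0 := by
    intro v hv
    by_contra hne
    -- A non-null kernel vector would split off as an orthogonal flat line.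
    have hcompl := BilinForm.isCompl_span_singleton_orthogonal hne
    have hv0 : v ≠ 0 := by rintro rfl; simp at hne
    rcases hM.eq_bot_or_eq_bot hcompl (fun x hx y hy => hy x hx) (fun x hx y _ => by
      obtain ⟨a, rfl⟩ := Submodule.mem_span_singleton.1 hx
      simp [LinearMap.mem_ker.1 hv]) with h | h
    · exact hv0 (Submodule.span_singleton_eq_bot.1 h)
    · rw [h] at hcompl
      refine hdim ?_
      rw [← finrank_top ℝ V, ← eq_top_of_isCompl_bot hcompl, finrank_span_singleton hv0]
  intro v hv w hw
  have h1 := hself _ (add_mem hv hw)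
  simp only [map_add, LinearMap.add_apply, hself v hv, hself w hw, M.form_comm w v] at h1
  linarith

variable [FiniteDimensional ℝ V]

theorem IsTwoStepJacobiNilpotent.polarJacobi_polarJacobi (h : M.IsTwoStepJacobiNilpotent)
    (x y z w v : V) : M.polarJacobi x y (M.polarJacobi z w v) = 0 := by
  have h' : ∀ x y v, M.jacobi x (M.jacobi y v) = 0 := fun x y v => LinearMap.congr_fun (h x y) v
  simp only [polarJacobi, LinearMap.sub_apply, map_sub, h', sub_zero]

/-- As `3u` is a difference of values of `P`, every `P(a, b)` kills `u`. So `A(u, a, b, w)` is skew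
in `a, b`, and Bianchi then reads `3 A(u, a, b, w) = 0`. -/
theorem IsTwoStepJacobiNilpotent.curvOp_mem_ker (h : M.IsTwoStepJacobiNilpotent) (x y z : V) :
    M.curvOp x y z ∈ LinearMap.ker M.A := by
  set u := M.curvOp x y z with hu
  have hP : ∀ a b, M.polarJacobi a b u = 0 := by
    intro a b
    have h3 := congrArg (M.polarJacobi a b) (M.three_smul_curvOp x y z)
    rw [map_smul, map_sub, h.polarJacobi_polarJacobi, h.polarJacobi_polarJacobi, sub_zero] at h3
    exact (smul_eq_zero.1 h3).resolve_left three_ne_zero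
  have hanti : ∀ a b w, M.A u a b w = -M.A u b a w := by
    intro a b w
    have h1 := hP a b
    rw [polarJacobi_apply] at h1
    rw [← form_curvOp, ← form_curvOp, eq_neg_of_add_eq_zero_left h1, map_neg, LinearMap.neg_apply]
  rw [LinearMap.mem_ker]
  ext a b w
  have b1 := M.curvature.bianchi u a b w
  have b2 : M.A b u a w = M.A u a b w := by rw [M.curvature.antisymm, hanti a b]
  have b3 : M.A a b u w = M.A u a b w := by
    rw [M.curvature.pair_symm, hanti, M.curvature.antisymm_right u a w b, neg_neg]
  simp only [LinearMap.zero_apply]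
  linarith

theorem isTwoStepSkewCurvatureNilpotent_of_curvOp_mem_ker
    (h : ∀ x y z, M.curvOp x y z ∈ LinearMap.ker M.A) : M.IsTwoStepSkewCurvatureNilpotent := by
  intro x₁ x₂ x₃ x₄
  ext z
  refine M.eq_zero_of_form_eq_zero fun w => ?_
  rw [Module.End.mul_apply, form_curvOp, A_apply_third_of_mem_ker (h _ _ _)]
  rfl

theorem IsTwoStepSkewCurvatureNilpotent.isTwoStepJacobiNilpotent
    (h : M.IsTwoStepSkewCurvatureNilpotent) : M.IsTwoStepJacobiNilpotent := by
  intro x y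
  ext z
  refine M.eq_zero_of_form_eq_zero fun w => ?_
  rw [Module.End.mul_apply, form_jacobi, M.curvature.pair_symm, jacobi_apply, ← form_curvOp,
    ← Module.End.mul_apply, h]
  simp

/-- With `R` the span of all `𝒜(x, y) z`, the symmetries give `R^⊥ ≤ ker A`. Taking orthogonals,
`(ker A)^⊥ ≤ R ≤ ker A`. -/
theorem IsTwoStepSkewCurvatureNilpotent.orthogonal_ker_le (h : M.IsTwoStepSkewCurvatureNilpotent) :
    M.form.orthogonal (LinearMap.ker M.A) ≤ LinearMap.ker M.A := by
  set R : Submodule ℝ V := Submodule.span ℝ {u | ∃ x y z, M.curvOp x y z = u}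
  have hR : M.form.orthogonal R ≤ LinearMap.ker M.A := by
    intro w hw
    rw [LinearMap.mem_ker]
    ext x y z
    have h1 : M.form (M.curvOp y z x) w = 0 := hw _ (Submodule.subset_span ⟨y, z, x, rfl⟩)
    rw [M.curvature.pair_symm, M.curvature.antisymm_right, ← form_curvOp, h1]
    simp
  refine (BilinForm.orthogonal_le hR).trans ?_
  rw [BilinForm.orthogonal_orthogonal M.form_nondegenerate M.form_symm.isRefl, Submodule.span_le]
  rintro _ ⟨x, y, z, rfl⟩
  exact h.isTwoStepJacobiNilpotent.curvOp_mem_ker x y z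

/-- A totally isotropic subspace containing its orthogonal has a totally isotropic complement. -/
theorem TotallyIsotropic.exists_isCompl {K : Submodule ℝ V} (hK : M.TotallyIsotropic K)
    (hKo : M.form.orthogonal K ≤ K) : ∃ W, IsCompl W K ∧ M.TotallyIsotropic W := by
  obtain ⟨U, hU⟩ := K.exists_isCompl
  -- An arbitrary complement `U` is sheared along `K`. The factor `1/2` makes the two cross terms in
  -- `⟨u - T u, v - T v⟩` cancel `⟨u, v⟩`.
  set T : V →ₗ[ℝ] V := (M.form.toDual M.form_nondegenerate).symm.toLinearMap ∘ₗ
    (M.form.compl₂ ((1 / 2 : ℝ) • U.projection K hU.symm)) with hT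
  have hTf : ∀ v w, M.form (T v) w = 1 / 2 * M.form v (U.projection K hU.symm w) := by
    intro v w
    simp [hT]
  have hTK : ∀ v, T v ∈ K := by
    intro v
    apply hKo
    intro k hk
    show M.form k (T v) = 0
    rw [form_comm, hTf, (Submodule.projection_apply_eq_zero_iff hU.symm).2 hk, map_zero, mul_zero]
  refine ⟨U.map (LinearMap.id - T), ⟨?_, ?_⟩, ?_⟩
  · rw [Submodule.disjoint_def]
    rintro _ ⟨u, hu, rfl⟩ hk
    have hk' : u - T u ∈ K := hk
    have huK : u ∈ K := by simpa using add_mem hk' (hTK u)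
    have : u = 0 := Submodule.disjoint_def.1 hU.disjoint u huK hu
    simp [this]
  · rw [codisjoint_iff, eq_top_iff]
    intro v _
    obtain ⟨k, hk, u, hu, rfl⟩ :=
      Submodule.mem_sup.1 (hU.sup_eq_top ▸ Submodule.mem_top : v ∈ K ⊔ U)
    refine Submodule.mem_sup.2 ⟨u - T u, ⟨u, hu, rfl⟩, k + T u, add_mem hk (hTK u), by abel⟩
  · rintro _ ⟨u, hu, rfl⟩ _ ⟨v, hv, rfl⟩
    have p1 : U.projection K hU.symm u = u := Submodule.projection_eq_self_iff hU.symm u |>.2 hu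
    have p2 : U.projection K hU.symm v = v := Submodule.projection_eq_self_iff hU.symm v |>.2 hv
    simp only [LinearMap.sub_apply, LinearMap.id_apply, map_sub, hK _ (hTK u) _ (hTK v),
      M.form_comm u (T v)]
    rw [hTf, hTf, p1, p2, M.form_comm v u]
    ring

theorem SplitsIsotropically.isTwoStepSkewCurvatureNilpotent (h : M.SplitsIsotropically) :
    M.IsTwoStepSkewCurvatureNilpotent := by
  obtain ⟨W, W', hc, A, hW, hW', -, -, hA⟩ := h
  have hker : W' ≤ LinearMap.ker M.A := by
    intro k hk
    rw [LinearMap.mem_ker]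
    ext y z w
    rw [hA, Tensor4.directSum_apply, (Submodule.projectionOnto_apply_eq_zero_iff hc).2 hk]
    simp
  refine isTwoStepSkewCurvatureNilpotent_of_curvOp_mem_ker fun x y z => hker ?_
  have hperp : ∀ k ∈ W', M.form (M.curvOp x y z) k = 0 := by
    intro k hk
    rw [form_curvOp, M.curvature.antisymm_right, A_apply_third_of_mem_ker (hker hk)]
    simp
  obtain ⟨a, ha, b, hb, hab⟩ :=
    Submodule.mem_sup.1 (hc.sup_eq_top ▸ Submodule.mem_top : M.curvOp x y z ∈ W ⊔ W')
  -- The `W`-component is orthogonal to `W` by isotropy and to `W'` by `hperp`.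
  have ha0 : a = 0 := by
    refine M.eq_zero_of_form_eq_zero fun v => ?_
    obtain ⟨c, hc', d, hd, rfl⟩ :=
      Submodule.mem_sup.1 (hc.sup_eq_top ▸ Submodule.mem_top : v ∈ W ⊔ W')
    have h1 := hperp d hd
    rw [← hab, map_add, LinearMap.add_apply, hW' b hb d hd, add_zero] at h1
    rw [map_add, hW a ha c hc', h1, add_zero]
  rw [← hab, ha0, zero_add]
  exact hb

theorem Indecomposable.splitsIsotropically (hM : M.Indecomposable)
    (hdim : Module.finrank ℝ V ≠ 1) (h : M.IsTwoStepSkewCurvatureNilpotent) :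
    M.SplitsIsotropically := by
  have hK := hM.totallyIsotropic_ker hdim
  have hKo := h.orthogonal_ker_le
  set K := LinearMap.ker M.A with hKdef
  obtain ⟨W, hc, hW⟩ := hK.exists_isCompl hKo
  have hAW : M.A = Tensor4.directSum hc (M.A.pullback W.subtype) 0 := by
    have h1 := M.curvature.eq_directSum hc fun x _ y hy => A_apply_right_of_mem_ker hy x
    have h2 : M.A.pullback K.subtype = 0 := by
      ext x y z w
      rw [Tensor4.pullback_apply, Submodule.subtype_apply, LinearMap.mem_ker.1 x.2]
      rfl
    rwa [h2] at h1
  refine ⟨W, K, hc, _, hW, hK, M.curvature.pullback _, ?_, hAW⟩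
  rintro ⟨W₁, W₂, hc', A₁, A₂, hne₁, hne₂, -, -, hsplit⟩
  -- Under the duality of `K` with `W`, these are the annihilators of `W₂` and `W₁`, that is, the
  -- duals of `W₁` and `W₂`.
  set K₁ := K ⊓ M.form.orthogonal (W₂.map W.subtype) with hK₁
  set K₂ := K ⊓ M.form.orthogonal (W₁.map W.subtype) with hK₂
  have horth : ∀ x ∈ W₁.map W.subtype ⊔ K₁, ∀ y ∈ W₂.map W.subtype ⊔ K₂, M.form x y = 0 := by
    intro x hx y hy
    obtain ⟨_, ⟨a, ha, rfl⟩, k, hk, rfl⟩ := Submodule.mem_sup.1 hx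
    obtain ⟨_, ⟨b, hb, rfl⟩, l, hl, rfl⟩ := Submodule.mem_sup.1 hy
    have h1 : M.form a l = 0 := hl.2 _ ⟨a, ha, rfl⟩
    have h2 : M.form k b = 0 := by rw [form_comm]; exact hk.2 _ ⟨b, hb, rfl⟩
    simp [hW a a.2 b b.2, h1, h2, hK k hk.1 l hl.1]
  have hmix : ∀ x ∈ W₁.map W.subtype ⊔ K₁, ∀ y ∈ W₂.map W.subtype ⊔ K₂, M.A x y = 0 := by
    intro x hx y hy
    obtain ⟨_, ⟨a, ha, rfl⟩, k, hk, rfl⟩ := Submodule.mem_sup.1 hx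
    obtain ⟨_, ⟨b, hb, rfl⟩, l, hl, rfl⟩ := Submodule.mem_sup.1 hy
    have hab : M.A a b = 0 := by
      rw [hAW]
      ext z w
      rw [Tensor4.directSum_apply, Submodule.projectionOnto_apply_left,
        Submodule.projectionOnto_apply_left, hsplit, Tensor4.directSum_apply_mixed hc' _ _ ha hb]
      simp
    simp only [Submodule.subtype_apply, map_add, hab,
      LinearMap.mem_ker.1 hk.1, A_apply_right_of_mem_ker hl.1, add_zero]
  have hKle : K ≤ K₁ ⊔ K₂ := by
    intro k hk
    set p : V →ₗ[ℝ] V := W.subtype ∘ₗ W₁.projection W₂ hc' ∘ₗ W.projectionOnto K hc with hp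
    -- `k₁` represents the functional `⟨k, ·⟩` restricted to `W₁` and extended by zero on `W₂` and
    -- `K`.
    obtain ⟨k₁, hk₁⟩ : ∃ k₁, ∀ v, M.form k₁ v = M.form k (p v) :=
      ⟨(M.form.toDual M.form_nondegenerate).symm (M.form k ∘ₗ p), fun v =>
        BilinForm.apply_toDual_symm_apply (hB := M.form_nondegenerate) (M.form k ∘ₗ p) v⟩
    have hk₁K : k₁ ∈ K := hKo fun l hl => by
      show M.form l k₁ = 0
      rw [form_comm, hk₁, hp]
      simp [(Submodule.projectionOnto_apply_eq_zero_iff hc).2 hl]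
    refine Submodule.mem_sup.2 ⟨k₁, ⟨hk₁K, ?_⟩, k - k₁, ⟨sub_mem hk hk₁K, ?_⟩, by abel⟩
    · rintro _ ⟨b, hb, rfl⟩
      show M.form b k₁ = 0
      rw [form_comm, hk₁, hp]
      simp [(Submodule.projection_apply_eq_zero_iff hc').2 hb]
    · rintro _ ⟨a, ha, rfl⟩
      show M.form a (k - k₁) = 0
      rw [form_comm, map_sub, LinearMap.sub_apply, hk₁, hp]
      simp [Submodule.projection_apply_of_mem_left hc' ha]
  have hsup : (W₁.map W.subtype ⊔ K₁) ⊔ (W₂.map W.subtype ⊔ K₂) = ⊤ := by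
    rw [sup_sup_sup_comm, ← Submodule.map_sup, hc'.sup_eq_top, Submodule.map_top,
      Submodule.range_subtype, eq_top_iff, ← hc.sup_eq_top]
    exact sup_le_sup_left hKle W
  have hcompl : IsCompl (W₁.map W.subtype ⊔ K₁) (W₂.map W.subtype ⊔ K₂) := by
    -- A common vector is orthogonal to both summands, hence to all of `V`.
    refine ⟨Submodule.disjoint_def.2 fun v hv₁ hv₂ => M.eq_zero_of_form_eq_zero fun w => ?_,
      codisjoint_iff.2 hsup⟩
    obtain ⟨a, ha, b, hb, rfl⟩ := Submodule.mem_sup.1 (hsup ▸ Submodule.mem_top : w ∈ _)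
    rw [map_add, horth v hv₁ b hb, form_comm, horth a ha v hv₂, add_zero]
  have hmap : ∀ U : Submodule ℝ W, U.map W.subtype = ⊥ → U = ⊥ := fun U hU =>
    (Submodule.map_injective_of_injective W.injective_subtype) (by rw [hU, Submodule.map_bot])
  rcases hM.eq_bot_or_eq_bot hcompl horth hmix with h0 | h0
  · exact hne₁ (hmap _ (sup_eq_bot_iff.1 h0).1)
  · exact hne₂ (hmap _ (sup_eq_bot_iff.1 h0).1)

end ZeroModel

theorem theorem1p2 {V : Type*} [AddCommGroup V] [Module ℝ V] [FiniteDimensional ℝ V]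
    (M : ZeroModel V) :
    (M.IsJacobiTsankov ∨ M.IsMixedTsankov →
      (∀ x : V, M.jacobi x ^ 2 = 0) ∧ (M.signature.1 = 0 ∨ M.signature.1 = 1 → M.A = 0)) ∧
    (M.IsJacobiTsankov → Module.finrank ℝ V < 14 → M.IsTwoStepJacobiNilpotent) ∧
    (M.Indecomposable → Module.finrank ℝ V ≠ 1 →
      [M.IsTwoStepJacobiNilpotent, M.IsTwoStepSkewCurvatureNilpotent,
        M.SplitsIsotropically].TFAE) := by
  refine ⟨fun h => ?_, fun h => h.isTwoStepJacobiNilpotent, fun hM hdim => ?_⟩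
  · have hJ : ∀ x v, M.jacobi x (M.jacobi x v) = 0 := fun x v =>
      h.elim (fun h => h.jacobi_jacobi_self x v) (fun h => h.jacobi_jacobi_self x v)
    exact ⟨fun x => by rw [sq]; exact LinearMap.ext (hJ x),
      ZeroModel.A_eq_zero_of_signature hJ⟩
  · tfae_have 1 → 2 := fun h =>
      ZeroModel.isTwoStepSkewCurvatureNilpotent_of_curvOp_mem_ker h.curvOp_mem_ker
    tfae_have 2 → 1 := fun h => h.isTwoStepJacobiNilpotent
    tfae_have 2 → 3 := hM.splitsIsotropically hdim
    tfae_have 3 → 2 := fun h => h.isTwoStepSkewCurvatureNilpotent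
    tfae_finish
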